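/- All graphs are finite and simple. Let $G$ be a graph of order $n$ with $e(G)$ edges and minimum degree at least $\delta$, where $\delta\ge 0$ is an integer. For $k\ge 1$, a $k$-factor of $G$ is a $k$-regular spanning subgraph. For a positive integer $l$, the $l$-closure $C_l(G)$ is the graph obtained from $G$ by successively joining pairs of distinct nonadjacent vertices whose degree sum (in the current graph) is at least $l$, until no such pair exists. Write $G_1+G_2$ for the disjoint union and $G_1\vee G_2$ for the join of two vertex-disjoint graphs, $K_m$ for the complete graph on $m$ vertices and $I_m$ for the graph with $m$ vertices and no edges. For integers $n,r,k,q$ put $$\varphi(n,r,q)=\binom{n-q-1}{r}+(q+1)\binom{q}{r-1},\qquad \phi(n,r,k,q)=\binom{n-q+2k-4}{r}+(q-2k+4)\binom{q}{r-1}.$$ (i) Suppose that $n$ is even, $n\ge 6\delta+10$, $1\le\delta\le \frac n2-1$ and $e(G)>\varphi(n,2,\delta+1)$. Then $G$ has a $1$-factor unless either $\delta$ is even and $C_{n-1}(G)\cong K_{n-\delta-1}+K_{\delta+1}$, or $C_{n-1}(G)\cong K_\delta\vee(K_{n-2\delta-1}+I_{\delta+1})$; in these two exceptional cases $G$ has no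 $1$-factor. (ii) Let $k\ge 2$ be an integer. Suppose that $nk$ is even, $n\ge 6\delta+4k-3$, $2k-2\le\delta\le\left\lfloor\frac{n+2k-5}{2}\right\rfloor$ and $e(G)>\phi(n,2,k,\delta+1)$. Then $G$ has a $k$-factor. -/

import Mathlib

namespace KFactor

/-- The function `φ(n,r,q) = C(n-q-1, r) + (q+1) C(q, r-1)` of integers `n, q` (and `r ≥ 1`). -/
def phiOne (n : ℤ) (r : ℕ) (q : ℤ) : ℤ :=
  Ring.choose (n - q - 1) r + (q + 1) * Ring.choose q (r - 1)

/-- The function `ϕ(n,r,k,q) = C(n-q+2k-4, r) + (q-2k+4) C(q, r-1)` of integers `n, k, q`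
(and `r ≥ 1`). -/
def phiTwo (n : ℤ) (r : ℕ) (k q : ℤ) : ℤ :=
  Ring.choose (n - q + 2 * k - 4) r + (q - 2 * k + 4) * Ring.choose q (r - 1)

open scoped Classical in
/-- `G` has a `k`-factor: a `k`-regular spanning subgraph. -/
def HasFactor {V : Type*} [Fintype V] (G : SimpleGraph V) (k : ℕ) : Prop :=
  ∃ F : SimpleGraph V, F ≤ G ∧ F.IsRegularOfDegree k

/-- The join `G ∨ H`: the disjoint union together with all edges between the two parts. -/
def join {V W : Type*} (G : SimpleGraph V) (H : SimpleGraph W) : SimpleGraph (V ⊕ W) :=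
  (G ⊕g H) ⊔ completeBipartiteGraph V W

section Closure

variable {V : Type*} [Fintype V]

open scoped Classical in
/-- `u` and `v` are distinct nonadjacent vertices of `G` with degree sum at least `l`. -/
def Joinable (l : ℕ) (G : SimpleGraph V) (u v : V) : Prop :=
  u ≠ v ∧ ¬ G.Adj u v ∧ l ≤ G.degree u + G.degree v

/-- `H` arises from `G` by joining one pair of nonadjacent vertices with degree sum at
least `l`. -/
def ClosureStep (l : ℕ) (G H : SimpleGraph V) : Prop :=
  ∃ u v : V, Joinable l G u v ∧ H = G ⊔ SimpleGraph.edge u v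

/-- `H` is obtained from `G` by successively joining nonadjacent pairs with degree sum at
least `l` until no such pair exists. -/
def IsClosure (l : ℕ) (G H : SimpleGraph V) : Prop :=
  Relation.ReflTransGen (ClosureStep l) G H ∧ ∀ u v : V, ¬ Joinable l H u v

theorem exists_isClosure (l : ℕ) (G : SimpleGraph V) : ∃ H, IsClosure l G H := by
  induction G using WellFoundedGT.induction with
  | ind G ih =>
    by_cases h : ∀ u v : V, ¬ Joinable l G u v
    · exact ⟨G, .refl, h⟩
    · push Not at h
      obtain ⟨u, v, huv⟩ := h
      obtain ⟨H, hH, hc⟩ := ih _ (SimpleGraph.lt_sup_edge G u v huv.1 huv.2.1)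
      exact ⟨H, .head ⟨u, v, huv, rfl⟩ hH, hc⟩

theorem IsClosure.le_of_closed {l : ℕ} {G H K : SimpleGraph V}
    (hH : Relation.ReflTransGen (ClosureStep l) G H) (hGK : G ≤ K)
    (hK : ∀ u v : V, ¬ Joinable l K u v) : H ≤ K := by
  classical
  induction hH with
  | refl => exact hGK
  | tail _ hs ih =>
    obtain ⟨u, v, ⟨hne, -, hd⟩, rfl⟩ := hs
    refine sup_le ih ((SimpleGraph.edge_le_iff _).2 (Or.inr ?_))
    by_contra hn
    exact hK u v ⟨hne, hn, hd.trans
      (add_le_add (SimpleGraph.degree_le_of_le ih) (SimpleGraph.degree_le_of_le ih))⟩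

theorem IsClosure.le {l : ℕ} {G H : SimpleGraph V} (h : IsClosure l G H) : G ≤ H := by
  obtain ⟨h, -⟩ := h
  induction h with
  | refl => exact le_rfl
  | tail _ hs ih =>
    obtain ⟨u, v, -, rfl⟩ := hs
    exact ih.trans le_sup_left

/-- The result of the closure process does not depend on the choices made. -/
theorem IsClosure.unique {l : ℕ} {G H K : SimpleGraph V} (hH : IsClosure l G H)
    (hK : IsClosure l G K) : H = K :=
  le_antisymm (IsClosure.le_of_closed hH.1 hK.le hK.2) (IsClosure.le_of_closed hK.1 hH.le hH.2)

/-- The `l`-closure `C_l(G)`. -/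
noncomputable def closure (l : ℕ) (G : SimpleGraph V) : SimpleGraph V :=
  Classical.choose (exists_isClosure l G)

theorem closure_isClosure (l : ℕ) (G : SimpleGraph V) : IsClosure l G (closure l G) :=
  Classical.choose_spec (exists_isClosure l G)

end Closure

end KFactor

/-! A factor of `G + uv` that uses `uv` becomes, once this edge is deleted, a subgraph F of G with
all degrees k except for a deficit of one at u and at v. Adding `ua` and deleting `ax` (`shift`)
moves a deficit from u to x. If G has no k-factor, the switches that would complete F are
impossible; double counting of F-edges then bounds deg u + deg v. So joining a pair of degree sum at
least `threshold` creates no new k-factor (`hasFactor_of_sup_edge`), and G may be replaced by its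
closure H.

Let t = n + δ - threshold. If H is not complete, the edge bound forces H to consist of a clique and
a set L of t vertices of degree δ (`exists_clique_compl`). If H is complete, a circulant graph is a
k-factor.

In the remaining case any new edge from L to the clique makes the closure complete. Hence, if H has
no k-factor, each u in L has an F with deficits at u and at a clique vertex. Two deficits inside the
clique can always be repaired, so no switch may move the deficit of u into the clique. This
determines F around L (`Tight.free_saturated`, `Tight.mem_free_of_adj`): it is contradictory for k ≥
2 and leaves the two extremal graphs for k = 1. -/

namespace KFactor

/-! ### Degree counting, switching and deficient subgraphs -/

section

open Finset
open scoped Classical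

variable {V : Type*}

/-- The indicator of the vertex `a`. -/
noncomputable def ind (a z : V) : ℕ := if z = a then 1 else 0

/-- The number of neighbours of `x` in `P`. -/
noncomputable def degIn (F : SimpleGraph V) (P : Finset V) (x : V) : ℕ := #{y ∈ P | F.Adj x y}

theorem sum_degIn_comm (F : SimpleGraph V) (P Q : Finset V) :
    ∑ p ∈ P, degIn F Q p = ∑ q ∈ Q, degIn F P q := by
  have := sum_card_bipartiteAbove_eq_sum_card_bipartiteBelow (s := P) (t := Q) F.Adj
  simp only [bipartiteAbove, bipartiteBelow] at this
  simp only [degIn, this]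
  refine sum_congr rfl fun q _ => ?_
  simp only [F.adj_comm]

/-- Replace the edge `ax` by the edge `ua`. -/
def shift (F : SimpleGraph V) (u a x : V) : SimpleGraph V :=
  (F ⊔ SimpleGraph.edge u a) \ SimpleGraph.edge a x

theorem shift_adj {F : SimpleGraph V} {u a x p q : V} :
    (shift F u a x).Adj p q ↔
      (F.Adj p q ∨ ((p = u ∧ q = a ∨ p = a ∧ q = u) ∧ p ≠ q)) ∧
        ¬ ((p = a ∧ q = x ∨ p = x ∧ q = a) ∧ p ≠ q) := by
  simp [shift, SimpleGraph.edge_adj]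

theorem shift_le {F G : SimpleGraph V} {u a x : V} (hF : F ≤ G) (h : G.Adj u a) :
    shift F u a x ≤ G :=
  sdiff_le.trans (sup_le hF ((SimpleGraph.edge_le_iff _).2 (Or.inr h)))

variable [Fintype V]

/-- The degree of `x`, independent of decidability instances. -/
noncomputable def deg (F : SimpleGraph V) (x : V) : ℕ := degIn F univ x

theorem degree_eq_deg (F : SimpleGraph V) (x : V) [Fintype (F.neighborSet x)] :
    F.degree x = deg F x := by
  rw [← SimpleGraph.card_neighborFinset_eq_degree, deg, degIn]
  congr 1
  ext y
  simp

theorem deg_mono {F G : SimpleGraph V} (h : F ≤ G) (x : V) : deg F x ≤ deg G x :=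
  card_le_card fun y hy => by
    rw [mem_filter] at hy ⊢
    exact ⟨hy.1, h hy.2⟩

theorem degIn_le_deg (F : SimpleGraph V) (P : Finset V) (x : V) : degIn F P x ≤ deg F x :=
  card_le_card (filter_subset_filter _ (subset_univ P))

theorem degIn_eq_deg {F : SimpleGraph V} {P : Finset V} {x : V} (h : ∀ y, F.Adj x y → y ∈ P) :
    degIn F P x = deg F x := by
  refine le_antisymm (degIn_le_deg F P x) (card_le_card fun y hy => ?_)
  rw [mem_filter] at hy ⊢
  exact ⟨h y hy.2, hy.2⟩

theorem mem_of_deg_le_degIn {F : SimpleGraph V} {P : Finset V} {x y : V}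
    (h : deg F x ≤ degIn F P x) (hy : F.Adj x y) : y ∈ P := by
  have := eq_of_subset_of_card_le (filter_subset_filter (F.Adj x) (subset_univ P)) h
  have hm : y ∈ ({y | F.Adj x y} : Finset V) := by simpa using hy
  rw [← this] at hm
  exact (mem_filter.1 hm).1

theorem degIn_add_degIn_compl (F : SimpleGraph V) (P : Finset V) (x : V) :
    degIn F P x + degIn F Pᶜ x = deg F x := by
  rw [deg, degIn, degIn, ← card_union_of_disjoint
    (disjoint_filter_filter disjoint_compl_right), ← filter_union, union_compl, degIn]

/-- Double counting: if all neighbours of `P` lie in `Q`, then the degrees of `P` sum to the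
number of pairs between `Q` and `P`. -/
theorem sum_deg_eq_sum_degIn {F : SimpleGraph V} {P Q : Finset V}
    (h : ∀ p ∈ P, ∀ q, F.Adj p q → q ∈ Q) : ∑ p ∈ P, deg F p = ∑ q ∈ Q, degIn F P q := by
  rw [← sum_degIn_comm]
  exact sum_congr rfl fun p hp => (degIn_eq_deg (h p hp)).symm

theorem deg_sup_edge {F : SimpleGraph V} {a b : V} (hab : a ≠ b) (h : ¬ F.Adj a b) (z : V) :
    deg (F ⊔ SimpleGraph.edge a b) z = deg F z + ind a z + ind b z := by
  have h' : ¬ F.Adj b a := fun h1 => h h1.symm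
  simp only [deg, degIn, SimpleGraph.sup_adj, SimpleGraph.edge_adj]
  by_cases ha : z = a
  · subst ha
    have e := card_insert_of_notMem (s := univ.filter (F.Adj z)) (a := b) (by simpa using h)
    rw [show ind z z = 1 by simp [ind], show ind b z = 0 by simp [ind, hab], add_zero, ← e]
    congr 1
    ext y
    simp only [mem_filter, mem_insert, mem_univ, true_and]
    grind
  · by_cases hb : z = b
    · subst hb
      have e := card_insert_of_notMem (s := univ.filter (F.Adj z)) (a := a) (by simpa using h')
      rw [show ind z z = 1 by simp [ind], show ind a z = 0 by simp [ind, ha], add_zero, ← e]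
      congr 1
      ext y
      simp only [mem_filter, mem_insert, mem_univ, true_and]
      grind
    · simp [ind, ha, hb]

theorem deg_sdiff_edge {F : SimpleGraph V} {a b : V} (h : F.Adj a b) (z : V) :
    deg (F \ SimpleGraph.edge a b) z + ind a z + ind b z = deg F z := by
  have hn : ¬ (F \ SimpleGraph.edge a b).Adj a b := by
    simp [SimpleGraph.edge_adj, h.ne]
  rw [← deg_sup_edge h.ne hn]
  congr 1
  exact sdiff_sup_cancel ((SimpleGraph.edge_le_iff _).2 (Or.inr h))

/-- Every vertex of `F` has degree `k`, except for a deficit of one at `x` and one at `y`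
(of two if `x = y`). -/
def Deficient (F : SimpleGraph V) (k : ℕ) (x y : V) : Prop :=
  ∀ z, deg F z + ind x z + ind y z = k

theorem Deficient.symm {F : SimpleGraph V} {k : ℕ} {x y : V} (h : Deficient F k x y) :
    Deficient F k y x := fun z => by have := h z; omega

theorem Deficient.deg_le {F : SimpleGraph V} {k : ℕ} {x y : V} (h : Deficient F k x y) (z : V) :
    deg F z ≤ k := by have := h z; omega

theorem Deficient.deg_eq {F : SimpleGraph V} {k : ℕ} {x y z : V} (h : Deficient F k x y)
    (hx : z ≠ x) (hy : z ≠ y) : deg F z = k := by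
  have := h z
  simpa [ind, hx, hy] using this

theorem Deficient.deg_left {F : SimpleGraph V} {k : ℕ} {x y : V} (h : Deficient F k x y)
    (hxy : x ≠ y) : deg F x + 1 = k := by
  have := h x
  simpa [ind, hxy] using this

theorem Deficient.shift {F : SimpleGraph V} {k : ℕ} {u v a x : V} (h : Deficient F k u v)
    (hua : u ≠ a) (hn : ¬ F.Adj u a) (hax : F.Adj a x) : Deficient (shift F u a x) k x v := by
  intro z
  have h1 := deg_sup_edge hua hn z
  have h2 := deg_sdiff_edge (F := F ⊔ SimpleGraph.edge u a) (a := a) (b := x) (Or.inl hax) z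
  have h3 := h z
  have h4 : deg (KFactor.shift F u a x) z =
      deg ((F ⊔ SimpleGraph.edge u a) \ SimpleGraph.edge a x) z := rfl
  omega

theorem hasFactor_iff {G : SimpleGraph V} {k : ℕ} :
    HasFactor G k ↔ ∃ F ≤ G, ∀ z, deg F z = k := by
  simp only [HasFactor, SimpleGraph.IsRegularOfDegree, degree_eq_deg]

theorem Deficient.hasFactor {F G : SimpleGraph V} {k : ℕ} {u v : V} (h : Deficient F k u v)
    (hF : F ≤ G) (huv : ¬ F.Adj u v) (hG : G.Adj u v) : HasFactor G k := by
  refine hasFactor_iff.2 ⟨F ⊔ SimpleGraph.edge u v, sup_le hF ((SimpleGraph.edge_le_iff _).2 (Or.inr hG)),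
    fun z => ?_⟩
  have := deg_sup_edge hG.ne huv z
  have h3 := h z
  omega

theorem HasFactor.mono {G H : SimpleGraph V} {k : ℕ} (h : HasFactor G k) (hGH : G ≤ H) :
    HasFactor H k := by
  obtain ⟨F, hF, hr⟩ := h
  exact ⟨F, hF.trans hGH, hr⟩

/-- A factor of `G + uv` is a factor of `G`, or uses `uv` and so is deficient at `u` and `v`
when this edge is removed. -/
theorem HasFactor.of_sup_edge {G : SimpleGraph V} {k : ℕ} {u v : V}
    (h : HasFactor (G ⊔ SimpleGraph.edge u v) k) :
    HasFactor G k ∨ ∃ F ≤ G, Deficient F k u v := by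
  obtain ⟨F, hF, hr⟩ := hasFactor_iff.1 h
  by_cases huv : F.Adj u v
  · refine Or.inr ⟨F \ SimpleGraph.edge u v, sdiff_le_iff.2 (by rwa [sup_comm]), fun z => ?_⟩
    rw [deg_sdiff_edge huv]
    exact hr z
  · refine Or.inl (hasFactor_iff.2 ⟨F, fun a b hab => ?_, hr⟩)
    have := hF hab
    simp only [SimpleGraph.sup_adj, SimpleGraph.edge_adj] at this
    rcases this with h | ⟨⟨rfl, rfl⟩ | ⟨rfl, rfl⟩, -⟩
    · exact h
    · exact absurd hab huv
    · exact absurd hab.symm huv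

end

/-! ### Stability of k-factors under closure -/

section

open Finset
open scoped Classical

variable {V : Type*} [Fintype V]

/-- The neighbours of `u` in `G` that are not neighbours of `u` in `F`. -/
noncomputable def free (G F : SimpleGraph V) (u : V) : Finset V := {a | G.Adj u a ∧ ¬ F.Adj u a}

theorem mem_free {G F : SimpleGraph V} {u a : V} :
    a ∈ free G F u ↔ G.Adj u a ∧ ¬ F.Adj u a := by simp [free]

theorem card_free_add_deg {G F : SimpleGraph V} (hF : F ≤ G) (u : V) :
    #(free G F u) + deg F u = deg G u := by
  rw [deg, deg, degIn, degIn, free, ← card_union_of_disjoint]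
  · congr 1
    ext y
    have := @hF u y
    simp only [mem_union, mem_filter, mem_univ, true_and]
    tauto
  · refine disjoint_filter.2 fun x _ h => h.2

/-- If all neighbours of `P` lie in `Q` and one further vertex of degree less than `k` in `P`,
then `P` is not larger than `Q`. -/
theorem card_le_card_of_adj {F : SimpleGraph V} {k : ℕ} {P Q : Finset V} {w : V}
    (hP : ∀ p ∈ P, deg F p = k) (hle : ∀ z, deg F z ≤ k) (hw : degIn F P w < k)
    (hPQ : ∀ p ∈ P, ∀ q, F.Adj p q → q = w ∨ q ∈ Q) : #P ≤ #Q := by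
  have h1 := sum_deg_eq_sum_degIn (F := F) (P := P) (Q := insert w Q)
    (fun p hp q hq => mem_insert.2 (hPQ p hp q hq))
  rw [sum_congr rfl hP, sum_const, smul_eq_mul] at h1
  have h2 : ∑ q ∈ insert w Q, degIn F P q ≤ degIn F P w + ∑ q ∈ Q, degIn F P q := by
    by_cases h : w ∈ Q
    · rw [insert_eq_of_mem h]
      exact Nat.le_add_left _ _
    · rw [sum_insert h]
  have h3 : ∑ q ∈ Q, degIn F P q ≤ #Q * k := by
    rw [← smul_eq_mul]
    exact sum_le_card_nsmul _ _ _ fun q _ => (degIn_le_deg F P q).trans (hle q)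
  have h4 : #P * k < (#Q + 1) * k := by
    rw [add_mul]
    omega
  have := Nat.lt_of_mul_lt_mul_right h4
  omega

variable {G F : SimpleGraph V} {k : ℕ} {u v : V}

/-- Otherwise adding ua, deleting ab and adding bv turns F into a k-factor. -/
theorem Deficient.not_adj_of_free (hd : Deficient F k u v) (hF : F ≤ G) (hG : ¬ HasFactor G k)
    {a b : V} (ha : a ∈ free G F u) (hb : b ∈ free G F v) : ¬ F.Adj a b := by
  intro hab
  rw [mem_free] at ha hb
  have hs := hd.shift ha.1.ne ha.2 hab
  refine hG (hs.hasFactor (shift_le hF ha.1) ?_ hb.1.symm)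
  rw [shift_adj]
  have := hab.ne
  have h1 : ¬ F.Adj b v := fun h => hb.2 h.symm
  have h2 : b ≠ u := by
    rintro rfl
    exact ha.2 hab.symm
  grind

theorem card_compl_insert_insert {u v : V} (huv : u ≠ v) {B : Finset V} (hu : u ∉ B) (hv : v ∉ B) :
    #(insert u (insert v B))ᶜ + #B + 2 = Fintype.card V := by
  have h1 : #(insert u (insert v B)) = #B + 2 := by
    rw [card_insert_of_notMem (by simp [huv, hu]), card_insert_of_notMem hv]
  have := card_compl_add_card (insert u (insert v B))
  omega

/-- The F-neighbours of vertices free for u avoid u and the vertices free for v. Among the possible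
neighbours, v need not be counted, since its F-degree is below k. -/
theorem Deficient.card_free_add_card_free_le (hd : Deficient F k u v) (hF : F ≤ G)
    (hG : ¬ HasFactor G k) (huv : u ≠ v) (hn : ¬ G.Adj u v) :
    #(free G F u) + #(free G F v) + 2 ≤ Fintype.card V := by
  have hvB : v ∉ free G F v := by simp [mem_free]
  have huB : u ∉ free G F v := by
    rw [mem_free]
    exact fun h => hn h.1.symm
  have hc := card_compl_insert_insert huv huB hvB
  have hlt := hd.symm.deg_left huv.symm
  have := card_le_card_of_adj (F := F) (k := k) (P := free G F u) (w := v)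
    (Q := (insert u (insert v (free G F v)))ᶜ) (fun p hp => ?_) hd.deg_le
    (by have := degIn_le_deg F (free G F u) v; omega) (fun p hp q hq => ?_)
  · omega
  · rw [mem_free] at hp
    refine hd.deg_eq hp.1.ne' ?_
    rintro rfl
    exact hn hp.1
  · have h1 : q ∉ free G F v := fun h => hd.not_adj_of_free hF hG hp h hq
    have h2 : q ≠ u := by
      rintro rfl
      exact (mem_free.1 hp).2 hq.symm
    simp only [mem_compl, mem_insert, not_or]
    tauto

/-- In the tight case some edge of `F` at `u` ends at a vertex that is free for `v`. -/
theorem Deficient.exists_adj_free (hd : Deficient F k u v) (hF : F ≤ G) (hG : ¬ HasFactor G k)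
    (huv : u ≠ v) (hn : ¬ G.Adj u v) (hk : 2 ≤ k)
    (hc : #(free G F u) + #(free G F v) + 2 = Fintype.card V) :
    ∃ b ∈ free G F v, F.Adj u b := by
  by_contra! hno
  have huA : u ∉ free G F u := by simp [mem_free]
  have hvA : v ∉ free G F u := by
    rw [mem_free]
    exact fun h => hn h.1
  set W := (insert u (insert v (free G F u)))ᶜ with hW
  have hWc : #W = #(free G F v) := by
    have := card_compl_insert_insert huv huA hvA
    rw [← hW] at this
    omega
  have hkv : ∀ p ∈ free G F v, deg F p = k := fun p hp => by
    rw [mem_free] at hp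
    refine hd.deg_eq ?_ hp.1.ne'
    rintro rfl
    exact hn hp.1.symm
  have hs := sum_deg_eq_sum_degIn (F := F) (P := free G F v) (Q := W) fun p hp q hq => by
    have h1 : q ∉ free G F u := fun h => hd.not_adj_of_free hF hG h hp hq.symm
    have h2 : q ≠ u := by
      rintro rfl
      exact hno p hp hq.symm
    have h3 : q ≠ v := by
      rintro rfl
      exact (mem_free.1 hp).2 hq.symm
    simp [hW, h1, h2, h3]
  rw [sum_congr rfl hkv, sum_const, smul_eq_mul, ← hWc, ← smul_eq_mul, ← sum_const] at hs
  have hle : ∀ w ∈ W, degIn F (free G F v) w ≤ k :=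
    fun w _ => (degIn_le_deg _ _ _).trans (hd.deg_le w)
  -- Equality in the count: all F-neighbours of a vertex of W are free for v. An F-neighbour w of u
  -- lies in W, so u would be free for v.
  have heq := (sum_eq_sum_iff_of_le hle).1 hs.symm
  have hdu := hd.deg_left huv
  obtain ⟨w, hw⟩ : ({y | F.Adj u y} : Finset V).Nonempty := card_pos.1 (by
    have : deg F u = #({y | F.Adj u y} : Finset V) := rfl
    omega)
  have hw : F.Adj u w := by simpa using hw
  have hwW : w ∈ W := by
    have h1 : w ≠ v := by
      rintro rfl
      exact hn (hF hw)
    simp [hW, mem_free, hw, hw.ne', h1]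
  have := mem_of_deg_le_degIn ((hd.deg_le w).trans (heq w hwW).ge) hw.symm
  exact hn (mem_free.1 this).1.symm

/-- Adding vb and deleting bu puts both deficits at u; an F-edge ac could then be replaced by ua and
cu. -/
theorem Deficient.not_adj_free_free (hd : Deficient F k u v) (hF : F ≤ G) (hG : ¬ HasFactor G k)
    {b a c : V} (hb : b ∈ free G F v) (hub : F.Adj u b) (ha : a ∈ free G F u)
    (hc : c ∈ free G F u) : ¬ F.Adj a c := by
  intro hac
  rw [mem_free] at ha hc hb
  have h1 := hd.symm.shift hb.1.ne hb.2 hub.symm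
  have hne := hac.ne
  have hab : a ≠ b := by
    rintro rfl
    exact ha.2 hub
  have hcb : c ≠ b := by
    rintro rfl
    exact hc.2 hub
  have hub' := hub.ne
  have hua := ha.1.ne
  have huc := hc.1.ne
  have huv : u ≠ v := by
    rintro rfl
    exact hb.2 hub
  have h2 := h1.shift (a := a) (x := c) hua
    (by rw [shift_adj]; have := ha.2; grind) (by rw [shift_adj]; grind)
  refine hG (h2.hasFactor (shift_le (shift_le hF hb.1) ha.1) ?_ hc.1.symm)
  have h3 : ¬ F.Adj c u := fun h => hc.2 h.symm
  simp only [shift_adj]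
  grind

/-- The F-neighbours of vertices free for u now avoid both free sets, so the count bounds the union
of these sets by the size of the second one. -/
theorem Deficient.free_subset_free (hd : Deficient F k u v) (hF : F ≤ G) (hG : ¬ HasFactor G k)
    (huv : u ≠ v) (hn : ¬ G.Adj u v) (hk : 2 ≤ k)
    (hc : #(free G F u) + #(free G F v) + 2 = Fintype.card V) :
    free G F u ⊆ free G F v := by
  obtain ⟨b, hb, hub⟩ := hd.exists_adj_free hF hG huv hn hk hc
  have huU : u ∉ free G F u ∪ free G F v := by
    simp only [mem_union, mem_free, not_or, not_and, SimpleGraph.irrefl, false_imp_iff, true_and]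
    exact fun h => absurd h.symm hn
  have hvU : v ∉ free G F u ∪ free G F v := by
    simp only [mem_union, mem_free, not_or, not_and, SimpleGraph.irrefl, false_imp_iff, and_true]
    exact fun h => absurd h hn
  have hc' := card_compl_insert_insert huv huU hvU
  have hlt := hd.symm.deg_left huv.symm
  have := card_le_card_of_adj (F := F) (k := k) (P := free G F u) (w := v)
    (Q := (insert u (insert v (free G F u ∪ free G F v)))ᶜ) (fun p hp => ?_) hd.deg_le
    (by have := degIn_le_deg F (free G F u) v; omega) (fun p hp q hq => ?_)
  · have hsub := eq_of_subset_of_card_le (subset_union_right (s₁ := free G F u) (s₂ := free G F v))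
      (by omega)
    rw [hsub]
    exact subset_union_left
  · rw [mem_free] at hp
    refine hd.deg_eq hp.1.ne' ?_
    rintro rfl
    exact hn hp.1
  · have h1 : q ∉ free G F v := fun h => hd.not_adj_of_free hF hG hp h hq
    have h2 : q ≠ u := by
      rintro rfl
      exact (mem_free.1 hp).2 hq.symm
    have h3 : q ∉ free G F u := fun h => hd.not_adj_free_free hF hG hb hub hp h hq
    simp only [mem_compl, mem_insert, not_or, mem_union]
    tauto

/-- In the tight case some vertex free for u is an F-neighbour of v, hence not free for v, against
the inclusion of the free sets. -/
theorem Deficient.card_free_add_card_free_lt (hd : Deficient F k u v) (hF : F ≤ G)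
    (hG : ¬ HasFactor G k) (huv : u ≠ v) (hn : ¬ G.Adj u v) (hk : 2 ≤ k) :
    #(free G F u) + #(free G F v) + 2 < Fintype.card V := by
  refine lt_of_le_of_ne (hd.card_free_add_card_free_le hF hG huv hn) fun hc => ?_
  have hsub := hd.free_subset_free hF hG huv hn hk hc
  obtain ⟨a, ha, hva⟩ := hd.symm.exists_adj_free hF hG huv.symm (fun h => hn h.symm) hk (by omega)
  exact (mem_free.1 (hsub ha)).2 hva

/-- The closure parameter for `k`-factors. -/
def threshold (n k : ℕ) : ℕ := if k = 1 then n - 1 else n + 2 * k - 4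

/-- As u has deg u - (k - 1) free vertices, and likewise v, the bounds on the free sets say deg u +
deg v ≤ n + 2k - 4, strictly for k ≥ 2. This explains the two cases of `threshold`. -/
theorem hasFactor_of_sup_edge (hj : Joinable (threshold (Fintype.card V) k) G u v)
    (h : HasFactor (G ⊔ SimpleGraph.edge u v) k) : HasFactor G k := by
  by_contra hG
  obtain h | ⟨F, hF, hd⟩ := h.of_sup_edge
  · exact hG h
  obtain ⟨huv, hn, hl⟩ := hj
  rw [degree_eq_deg, degree_eq_deg] at hl
  have h1 := card_free_add_deg hF u
  have h2 := card_free_add_deg hF v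
  have h3 := hd.deg_left huv
  have h4 := hd.symm.deg_left huv.symm
  have h5 := hd.card_free_add_card_free_le hF hG huv hn
  rw [threshold] at hl
  split_ifs at hl with hk1
  · omega
  · have := hd.card_free_add_card_free_lt hF hG huv hn (by omega)
    omega

theorem hasFactor_of_closure (h : HasFactor (closure (threshold (Fintype.card V) k) G) k) :
    HasFactor G k := by
  have hc := (closure_isClosure (threshold (Fintype.card V) k) G).1
  revert h
  generalize closure (threshold (Fintype.card V) k) G = H at hc
  induction hc with
  | refl => exact id
  | tail _ hs ih =>
    obtain ⟨a, b, hj, rfl⟩ := hs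
    exact fun h => ih (hasFactor_of_sup_edge hj h)

end

/-! ### Closed graphs with many edges, and regular factors of cliques -/

section

open Finset
open scoped Classical

variable {V : Type*} [Fintype V]

theorem sum_deg_eq_two_mul_card_edgeFinset (H : SimpleGraph V) [DecidableRel H.Adj] :
    ∑ z, deg H z = 2 * #H.edgeFinset := by
  rw [← H.sum_degrees_eq_twice_card_edges]
  exact sum_congr rfl fun z _ => (degree_eq_deg H z).symm

theorem sum_deg_le (H : SimpleGraph V) (U : Finset V) :
    ((∑ z, deg H z : ℕ) : ℤ) ≤
      (Fintype.card V - #U : ℤ) * (Fintype.card V - #U - 1) + 2 * (∑ z ∈ U, deg H z : ℕ) := by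
  have h1 := sum_add_sum_compl U (deg H)
  have h2 : ∑ z ∈ Uᶜ, deg H z = ∑ z ∈ Uᶜ, degIn H U z + ∑ z ∈ Uᶜ, degIn H Uᶜ z := by
    rw [← sum_add_distrib]
    exact sum_congr rfl fun z _ => (degIn_add_degIn_compl H U z).symm
  have h3 : ∑ z ∈ Uᶜ, degIn H U z ≤ ∑ z ∈ U, deg H z := by
    rw [sum_degIn_comm]
    exact sum_le_sum fun z _ => degIn_le_deg _ _ _
  have h4 : ∑ z ∈ Uᶜ, degIn H Uᶜ z ≤ #Uᶜ * (#Uᶜ - 1) := by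
    rw [← smul_eq_mul]
    refine sum_le_card_nsmul _ _ _ fun z hz => ?_
    rw [← card_erase_of_mem hz]
    refine card_le_card fun y hy => ?_
    rw [mem_filter] at hy
    exact mem_erase.2 ⟨hy.2.ne', hy.1⟩
  have h5 : ((#Uᶜ * (#Uᶜ - 1) : ℕ) : ℤ) =
      (Fintype.card V - #U : ℤ) * (Fintype.card V - #U - 1) := by
    have h6 := card_compl_add_card U
    have h7 : (Fintype.card V - #U : ℤ) = #Uᶜ := by rw [← h6]; push_cast; ring
    rw [h7]
    rcases Nat.eq_zero_or_pos #Uᶜ with h | h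
    · simp [h]
    · rw [Nat.cast_mul, Nat.cast_sub h, Nat.cast_one]
  rw [← h5]
  norm_cast
  omega

theorem card_nonadj_add_deg (H : SimpleGraph V) (v : V) :
    #({w | w ≠ v ∧ ¬ H.Adj v w} : Finset V) + deg H v + 1 = Fintype.card V := by
  have h : ({w | w ≠ v ∧ ¬ H.Adj v w} : Finset V) = (insert v ({w | H.Adj v w} : Finset V))ᶜ := by
    ext w
    simp
  have h1 := card_compl_add_card (insert v ({w | H.Adj v w} : Finset V))
  rw [card_insert_of_notMem (by simp)] at h1
  rw [h, deg, degIn]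
  omega

theorem exists_nonadj_max {H : SimpleGraph V} (hne : ∃ u v, u ≠ v ∧ ¬ H.Adj u v) :
    ∃ u v, u ≠ v ∧ ¬ H.Adj u v ∧ deg H u ≤ deg H v ∧ ∀ w, w ≠ v → ¬ H.Adj v w → deg H w ≤ deg H u := by
  obtain ⟨u₀, v₀, h₀⟩ := hne
  obtain ⟨⟨u, v⟩, hm, hmax⟩ := exists_max_image
    ({p | p.1 ≠ p.2 ∧ ¬ H.Adj p.1 p.2} : Finset (V × V)) (fun p => deg H p.1 + deg H p.2)
    ⟨(u₀, v₀), by simpa using h₀⟩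
  simp only [mem_filter, mem_univ, true_and, Prod.forall] at hm hmax
  rcases le_total (deg H u) (deg H v) with h | h
  · refine ⟨u, v, hm.1, hm.2, h, fun w hw hvw => ?_⟩
    have := hmax w v ⟨hw, fun h => hvw h.symm⟩
    omega
  · refine ⟨v, u, hm.1.symm, fun h => hm.2 h.symm, h, fun w hw hvw => ?_⟩
    have := hmax u w ⟨hw.symm, hvw⟩
    omega

/-- A closed graph with many edges that is not complete consists of a clique and a given number
of vertices of minimum degree. -/
theorem exists_clique_compl {H : SimpleGraph V} {l t δ : ℕ} (hl : l + t = Fintype.card V + δ)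
    (hcl : ∀ u v, ¬ Joinable l H u v) (hδ : ∀ z, δ ≤ deg H z)
    (hn : 5 * t + δ + 5 ≤ Fintype.card V)
    (he : ((Fintype.card V : ℤ) - t - 1) * (Fintype.card V - t - 2) + 2 * ((t + 1) * (δ + 1)) <
      (∑ z, deg H z : ℕ))
    (hne : ∃ u v, u ≠ v ∧ ¬ H.Adj u v) :
    ∃ L : Finset V, #L = t ∧ (∀ x ∈ L, deg H x = δ) ∧ ∀ x ∉ L, ∀ y ∉ L, x ≠ y → H.Adj x y := by
  have hcl' : ∀ x y, x ≠ y → ¬ H.Adj x y → deg H x + deg H y + 1 ≤ l := fun x y hxy hn => by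
    by_contra hlt
    refine hcl x y ⟨hxy, hn, ?_⟩
    rw [degree_eq_deg, degree_eq_deg]
    omega
  obtain ⟨u, v, huv, hadj, hle, hmax⟩ := exists_nonadj_max hne
  have hsum := hcl' u v huv hadj
  have hcard := card_nonadj_add_deg H v
  obtain ⟨j, hj⟩ := Nat.exists_eq_add_of_le (hδ u)
  -- Since deg u + deg v < l, there are at least t + j non-neighbours of v; by maximality each has
  -- degree at most δ + j.
  obtain ⟨U, hU, hUc⟩ := exists_subset_card_eq
    (s := ({w | w ≠ v ∧ ¬ H.Adj v w} : Finset V)) (n := t + j) (by omega)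
  have hUd : ∀ z ∈ U, deg H z ≤ δ + j := fun z hz => by
    have := hU hz
    simp only [mem_filter, mem_univ, true_and] at this
    exact hj ▸ hmax z this.1 this.2
  have hj0 : j = 0 := by
    by_contra hj0
    have h1 := sum_deg_le H U
    have h2 : ∑ z ∈ U, deg H z ≤ (t + j) * (δ + j) := by
      rw [← hUc, ← smul_eq_mul]
      exact sum_le_card_nsmul _ _ _ hUd
    rw [hUc] at h1
    have h3 : ((∑ z ∈ U, deg H z : ℕ) : ℤ) ≤ (t + j) * (δ + j) := by exact_mod_cast h2
    generalize (∑ z ∈ U, deg H z) = X at *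
    generalize (∑ z, deg H z) = Y at *
    have h4 : (1 : ℤ) ≤ j := by omega
    have h5 : (2 : ℤ) * j + δ + t + 1 ≤ Fintype.card V := by omega
    have h6 : (5 : ℤ) * t + δ + 5 ≤ Fintype.card V := by exact_mod_cast hn
    generalize (Fintype.card V : ℤ) = n at *
    push_cast at h1
    -- The bound of `he` is the case j = 1. It exceeds the bound for j by (j - 1) times the second
    -- factor here, which is nonnegative by `h5` and `h6`; the constants in `hn` serve this purpose.
    nlinarith [mul_nonneg (sub_nonneg.2 h4) (show (0 : ℤ) ≤ 2 * (n - t) - 4 - 3 * j - 2 * t - 2 * δ by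
      linarith)]
  subst hj0
  have hUd' : ∀ z ∈ U, deg H z = δ := fun z hz => le_antisymm (hUd z hz) (hδ z)
  refine ⟨U, hUc, hUd', fun x hx y hy hxy => ?_⟩
  -- With x and y added to U, the resulting bound on the degree sum is 2t below that of `he`.
  by_contra hnxy
  have h1 := sum_deg_le H (insert x (insert y U))
  have hxU : x ∉ insert y U := by simp [hxy, hx]
  rw [sum_insert hxU, sum_insert hy, card_insert_of_notMem hxU, card_insert_of_notMem hy, hUc,
    sum_congr rfl hUd', sum_const, hUc, smul_eq_mul] at h1
  have h2 : (deg H x : ℤ) + deg H y + 1 + t ≤ Fintype.card V + δ := by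
    have := hcl' x y hxy hnxy
    omega
  generalize (∑ z, deg H z) = Y at *
  generalize (Fintype.card V : ℤ) = n at *
  push_cast at h1
  nlinarith

/-- Connection sets for circulant graphs: elements are added in pairs z, -z, starting from the empty
set or, for odd k, from n/2. -/
theorem exists_symm_finset (n : ℕ) [NeZero n] : ∀ k : ℕ, k < n → Even (n * k) →
    ∃ S : Finset (ZMod n), 0 ∉ S ∧ (∀ x ∈ S, -x ∈ S) ∧ #S = k
  | 0, _, _ => ⟨∅, by simp⟩
  | 1, hk, he => by
    obtain ⟨m, hm⟩ : Even n := by simpa using he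
    have hv : (m : ZMod n).val = m := ZMod.val_natCast_of_lt (by omega)
    refine ⟨{(m : ZMod n)}, ?_, ?_, by simp⟩
    · rw [mem_singleton]
      intro h
      rw [← h, ZMod.val_zero] at hv
      omega
    · simp only [mem_singleton, forall_eq]
      rw [ZMod.neg_eq_self_iff, hv]
      omega
  | k + 2, hk, he => by
    obtain ⟨S, h0, hS, hc⟩ := exists_symm_finset n k (by omega) (by
      rw [mul_add] at he
      exact (Nat.even_add.1 he).2 (by simp))
    have hc1 := card_compl_add_card (insert (0 : ZMod n) S)
    rw [card_insert_of_notMem h0, hc, ZMod.card] at hc1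
    obtain ⟨x, hx, y, hy, hxy⟩ := one_lt_card.1 (show 1 < #(insert (0 : ZMod n) S)ᶜ by omega)
    simp only [mem_compl, mem_insert, not_or] at hx hy
    -- At most one nonzero element equals its own negative, so x or y serves.
    obtain ⟨z, hz0, hzS, hz⟩ : ∃ z : ZMod n, z ≠ 0 ∧ z ∉ S ∧ -z ≠ z := by
      by_cases h : -x = x
      · refine ⟨y, hy.1, hy.2, fun h' => hxy ?_⟩
        have h1 := ((ZMod.neg_eq_self_iff x).1 h).resolve_left hx.1
        have h2 := ((ZMod.neg_eq_self_iff y).1 h').resolve_left hy.1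
        exact ZMod.val_injective n (by omega)
      · exact ⟨x, hx.1, hx.2, h⟩
    have hnz : -z ∉ S := fun h => hzS (by simpa using hS _ h)
    refine ⟨insert z (insert (-z) S), by simp [hz0.symm, h0, hz0], fun w hw => ?_, ?_⟩
    · simp only [mem_insert] at hw ⊢
      rcases hw with rfl | rfl | hw
      · simp
      · simp
      · exact Or.inr (Or.inr (hS w hw))
    · rw [card_insert_of_notMem (by simp [hz.symm, hzS]), card_insert_of_notMem hnz, hc]

theorem hasFactor_top {k : ℕ} (hk : k < Fintype.card V) (he : Even (Fintype.card V * k)) :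
    HasFactor (⊤ : SimpleGraph V) k := by
  have : NeZero (Fintype.card V) := ⟨by omega⟩
  obtain ⟨S, h0, hS, hc⟩ := exists_symm_finset (Fintype.card V) k hk he
  let e : V ≃ ZMod (Fintype.card V) := Fintype.equivOfCardEq (ZMod.card _).symm
  refine hasFactor_iff.2 ⟨SimpleGraph.fromRel fun x y => e y - e x ∈ S, le_top, fun x => ?_⟩
  rw [← hc, deg, degIn]
  refine card_bij (fun y _ => e y - e x) (fun y hy => ?_) (fun y _ z _ h => ?_) (fun s hs => ?_)
  · simp only [SimpleGraph.fromRel_adj, mem_filter, mem_univ, true_and] at hy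
    rcases hy.2 with h | h
    · exact h
    · simpa using hS _ h
  · exact e.injective (by simpa using h)
  · refine ⟨e.symm (s + e x), ?_, by simp⟩
    simp only [SimpleGraph.fromRel_adj, mem_filter, mem_univ, true_and, Equiv.apply_symm_apply,
      add_sub_cancel_right, hs, true_or, and_true]
    intro h
    apply h0
    have h2 : e x = s + e x := by rw [← e.apply_symm_apply (s + e x), ← h]
    have h3 : s = 0 := by simpa using h2.symm
    rwa [h3] at hs

/-- Two deficits in a large clique can be repaired. -/
theorem Deficient.hasFactor_of_clique {H F : SimpleGraph V} {k : ℕ} {x y : V} {L : Finset V}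
    (hd : Deficient F k x y) (hF : F ≤ H) (hx : x ∉ L) (hy : y ∉ L)
    (hL : ∀ x ∉ L, ∀ y ∉ L, x ≠ y → H.Adj x y) (hc : 2 * #L + 2 * k + 4 < Fintype.card V) :
    HasFactor H k := by
  set P := (L ∪ insert x (insert y ({z | F.Adj x z} : Finset V)))ᶜ with hP
  set Q := (L ∪ insert x (insert y ({z | F.Adj y z} : Finset V)))ᶜ with hQ
  have hsz : ∀ w, #(L ∪ insert x (insert y ({z | F.Adj w z} : Finset V))) ≤ #L + k + 2 := fun w => by
    have h1 := card_union_le L (insert x (insert y ({z | F.Adj w z} : Finset V)))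
    have h2 := card_insert_le x (insert y ({z | F.Adj w z} : Finset V))
    have h3 := card_insert_le y ({z | F.Adj w z} : Finset V)
    have h4 : #({z | F.Adj w z} : Finset V) ≤ k := hd.deg_le w
    omega
  -- Otherwise counting gives |P| ≤ |Qᶜ|, although Pᶜ and Qᶜ have at most |L| + k + 2 elements each.
  have hex : ∃ p ∈ P, ∃ q ∈ Q, F.Adj p q := by
    by_contra! hno
    have hk : 1 ≤ k := by
      have := hd x
      have h1 : ind x x = 1 := by simp [ind]
      omega
    have := card_le_card_of_adj (F := F) (k := k) (P := P) (Q := Qᶜ) (w := x) (fun p hp => ?_)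
      hd.deg_le ?_ (fun p hp q hq => Or.inr (mem_compl.2 fun h => hno p hp q h hq))
    · have h1 := hsz x
      have h2 := hsz y
      have h3 := card_compl_add_card (L ∪ insert x (insert y ({z | F.Adj x z} : Finset V)))
      rw [← hP] at h3
      rw [hQ, compl_compl] at this
      omega
    · simp only [hP, mem_compl, mem_union, mem_insert, not_or] at hp
      exact hd.deg_eq hp.2.1 hp.2.2.1
    · have : degIn F P x = 0 := by
        rw [degIn, card_eq_zero, filter_eq_empty_iff]
        intro p hp hxp
        simp [hP, hxp] at hp
      omega
  obtain ⟨p, hp, q, hq, hpq⟩ := hex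
  simp only [hP, hQ, mem_compl, mem_union, mem_insert, not_or, mem_filter, mem_univ, true_and]
    at hp hq
  -- Add xp, delete pq, add qy. The case x = y is included.
  have h1 := hd.shift (Ne.symm hp.2.1) hp.2.2.2 hpq
  have hxp := hL x hx p hp.1 (Ne.symm hp.2.1)
  refine h1.hasFactor (shift_le hF hxp) ?_ (hL q hq.1 y hy hq.2.2.1)
  have h2 : ¬ F.Adj q y := fun h => hq.2.2.2 h.symm
  have h3 := hpq.ne
  rw [shift_adj]
  grind

end

/-! ### Tight graphs: a clique and a set L of vertices of degree δ -/

section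

open Finset
open scoped Classical

variable {V : Type*} [Fintype V]

theorem exists_adj_of_deg_pos {F : SimpleGraph V} {x : V} (h : 0 < deg F x) : ∃ y, F.Adj x y := by
  obtain ⟨y, hy⟩ := card_pos.1 h
  exact ⟨y, (mem_filter.1 hy).2⟩

theorem eq_of_deg_le_one {F : SimpleGraph V} {x y z : V} (h : deg F x ≤ 1) (hy : F.Adj x y)
    (hz : F.Adj x z) : y = z :=
  card_le_one.1 h y (by simpa using hy) z (by simpa using hz)

/-- Handshake lemma for the subgraph induced on P. -/
theorem even_sum_degIn (F : SimpleGraph V) (P : Finset V) : Even (∑ x ∈ P, degIn F P x) := by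
  let K : SimpleGraph V := SimpleGraph.fromRel fun x y => F.Adj x y ∧ x ∈ P ∧ y ∈ P
  have h : ∑ x ∈ P, degIn F P x = ∑ z, deg K z := by
    rw [← sum_add_sum_compl P (deg K), sum_eq_zero (s := Pᶜ), add_zero]
    · refine sum_congr rfl fun x hx => ?_
      rw [degIn, deg, degIn]
      congr 1
      ext y
      have := F.adj_comm x y
      have h1 : F.Adj x y → x ≠ y := fun h => h.ne
      simp only [K, SimpleGraph.fromRel_adj, mem_filter, mem_univ, true_and]
      tauto
    · intro x hx
      rw [mem_compl] at hx
      refine Nat.eq_zero_of_not_pos fun h => ?_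
      obtain ⟨y, hy⟩ := exists_adj_of_deg_pos h
      simp [K, hx] at hy
  rw [h, sum_deg_eq_two_mul_card_edgeFinset]
  exact even_two_mul _

variable {H F : SimpleGraph V} {L : Finset V} {k δ : ℕ} {u v : V}

/-- `H` consists of a clique and of a set `L` of vertices of degree `δ`, such that adding one edge
between them makes the closure complete. -/
structure Tight (H : SimpleGraph V) (L : Finset V) (k δ : ℕ) : Prop where
  threshold_add : threshold (Fintype.card V) k + #L = Fintype.card V + δ
  deg_eq : ∀ x ∈ L, deg H x = δ
  clique : ∀ x ∉ L, ∀ y ∉ L, x ≠ y → H.Adj x y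
  one_le : 1 ≤ k
  even : Even (Fintype.card V * k)
  large : 2 * #L + 2 * k + 4 < Fintype.card V
  add_lt : δ + #L < Fintype.card V

theorem card_le_deg_add_of_nonadj_mem {K : SimpleGraph V} {P : Finset V} {x : V}
    (h : ∀ y, y ≠ x → y ∉ P → K.Adj x y) : Fintype.card V ≤ deg K x + #P + 1 := by
  have h1 := card_nonadj_add_deg K x
  have h2 : #({w | w ≠ x ∧ ¬ K.Adj x w} : Finset V) ≤ #P := card_le_card fun y hy => by
    simp only [mem_filter, mem_univ, true_and] at hy
    by_contra hyP
    exact hy.2 (h y hy.1 hyP)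
  omega

/-- The closure becomes complete in three rounds: u, now of degree at least δ + 1, is joined to the
whole clique; this raises the clique degrees by one, so the rest of L is joined to the clique;
finally the vertices of L have degree large enough to be joined to each other. -/
theorem Tight.hasFactor_sup_edge (ht : Tight H L k δ) (hu : u ∈ L) (hv : v ∉ L)
    (hn : ¬ H.Adj u v) : HasFactor (H ⊔ SimpleGraph.edge u v) k := by
  have huv : u ≠ v := by
    rintro rfl
    exact hv hu
  refine hasFactor_of_closure ?_
  have hK := closure_isClosure (threshold (Fintype.card V) k) (H ⊔ SimpleGraph.edge u v)
  generalize closure (threshold (Fintype.card V) k) (H ⊔ SimpleGraph.edge u v) = K at hK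
  have hle := hK.le
  have hHK : H ≤ K := le_sup_left.trans hle
  have hcl : ∀ x y, x ≠ y → threshold (Fintype.card V) k ≤ deg K x + deg K y → K.Adj x y := by
    intro x y hxy h
    by_contra hnxy
    refine hK.2 x y ⟨hxy, hnxy, ?_⟩
    rwa [degree_eq_deg, degree_eq_deg]
  have hth := ht.threshold_add
  have h1 : δ + 1 ≤ deg K u := by
    have h2 := deg_mono hle u
    rw [deg_sup_edge huv hn, ht.deg_eq u hu] at h2
    have h3 : ind u u = 1 := by simp [ind]
    omega
  have h2 : ∀ y ∉ L, K.Adj u y := fun y hy => by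
    refine hcl u y (by rintro rfl; exact hy hu) ?_
    have := card_le_deg_add_of_nonadj_mem (K := K) (P := L) (x := y)
      fun z hz hzL => hHK (ht.clique y hy z hzL hz.symm)
    omega
  have h3 : ∀ x ∈ L, ∀ y ∉ L, K.Adj x y := fun x hx y hy => by
    refine hcl x y (by rintro rfl; exact hy hx) ?_
    have h4 := card_le_deg_add_of_nonadj_mem (K := K) (P := L.erase u) (x := y) fun z hz hzL => by
      by_cases hzu : z = u
      · exact hzu ▸ (h2 y hy).symm
      · exact hHK (ht.clique y hy z (fun h => hzL (mem_erase.2 ⟨hzu, h⟩)) hz.symm)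
    have h5 := card_erase_add_one hu
    have h6 := deg_mono hHK x
    rw [ht.deg_eq x hx] at h6
    omega
  have h4 : ∀ x ∈ L, Fintype.card V ≤ deg K x + #L := fun x hx => by
    have h5 := card_le_deg_add_of_nonadj_mem (K := K) (P := L.erase x) (x := x)
      fun z hz hzL => h3 x hx z fun h => hzL (mem_erase.2 ⟨hz, h⟩)
    have h6 := card_erase_add_one hx
    omega
  have htop : K = ⊤ := by
    refine top_le_iff.1 fun x y hxy => ?_
    have hxy : x ≠ y := hxy
    by_cases hx : x ∈ L
    · by_cases hy : y ∈ L
      · refine hcl x y hxy ?_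
        have h5 := h4 x hx
        have h6 := h4 y hy
        have h7 := ht.add_lt
        omega
      · exact h3 x hx y hy
    · by_cases hy : y ∈ L
      · exact (h3 y hy x hx).symm
      · exact hHK (ht.clique x hx y hy hxy)
  rw [htop]
  exact hasFactor_top (by have := ht.large; omega) ht.even

theorem Tight.exists_deficient (ht : Tight H L k δ) (hH : ¬ HasFactor H k) (hu : u ∈ L) :
    ∃ v ∉ L, ¬ H.Adj u v ∧ ∃ F ≤ H, Deficient F k u v := by
  obtain ⟨v, hv, hn⟩ : ∃ v ∉ L, ¬ H.Adj u v := by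
    by_contra! hall
    have h1 : #Lᶜ ≤ deg H u := card_le_card fun y hy => by
      simpa using hall y (by simpa using hy)
    have h2 := card_compl_add_card L
    rw [ht.deg_eq u hu] at h1
    have := ht.add_lt
    omega
  exact ⟨v, hv, hn, (ht.hasFactor_sup_edge hu hv hn).of_sup_edge.resolve_left hH⟩

theorem Tight.repair (ht : Tight H L k δ) (hd : Deficient F k u v) (hF : F ≤ H) (hu : u ∉ L)
    (hv : v ∉ L) : HasFactor H k :=
  hd.hasFactor_of_clique hF hu hv ht.clique ht.large

/-- Otherwise the deficit moves from u to x in the clique, where it can be repaired together with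
that of v. -/
theorem Tight.mem_of_adj_free (ht : Tight H L k δ) (hH : ¬ HasFactor H k) (hF : F ≤ H)
    (hd : Deficient F k u v) (hv : v ∉ L) {a x : V} (ha : a ∈ free H F u) (hax : F.Adj a x) :
    x ∈ L := by
  by_contra hx
  rw [mem_free] at ha
  exact hH (ht.repair (hd.shift ha.1.ne ha.2 hax) (shift_le hF ha.1) hx hv)

/-- The δ - k + 1 vertices free for u send all their F-edges to L \ {u}, which has δ elements for k
= 1 and δ + 3 - 2k for k ≥ 2. Hence k ≤ 2 and the count is an equality. -/
theorem Tight.free_saturated (ht : Tight H L k δ) (hH : ¬ HasFactor H k) (hF : F ≤ H)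
    (hd : Deficient F k u v) (hu : u ∈ L) (hv : v ∉ L) (hn : ¬ H.Adj u v) :
    k ≤ 2 ∧ ∀ x ∈ L, x ≠ u → ∀ y, F.Adj x y → y ∈ free H F u := by
  have huv : u ≠ v := by
    rintro rfl
    exact hv hu
  have hdeg : ∀ p ∈ free H F u, deg F p = k := fun p hp => by
    rw [mem_free] at hp
    refine hd.deg_eq hp.1.ne' ?_
    rintro rfl
    exact hn hp.1
  have hs := sum_deg_eq_sum_degIn (F := F) (P := free H F u) (Q := L.erase u) fun p hp q hq => by
    refine mem_erase.2 ⟨?_, ht.mem_of_adj_free hH hF hd hv hp hq⟩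
    rintro rfl
    exact (mem_free.1 hp).2 hq.symm
  rw [sum_congr rfl hdeg, sum_const, smul_eq_mul] at hs
  have hle : ∀ w ∈ L.erase u, degIn F (free H F u) w ≤ k :=
    fun w _ => (degIn_le_deg _ _ _).trans (hd.deg_le w)
  have hs2 := sum_le_sum hle
  rw [← hs, sum_const, smul_eq_mul] at hs2
  have hcle := Nat.le_of_mul_le_mul_right hs2 ht.one_le
  have h1 := card_free_add_deg hF u
  have h2 := hd.deg_left huv
  have h3 := ht.threshold_add
  have h4 := card_erase_add_one hu
  have h5 := ht.one_le
  have h6 := ht.large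
  rw [ht.deg_eq u hu] at h1
  have hceq : k ≤ 2 ∧ #(free H F u) = #(L.erase u) := by
    rw [threshold] at h3
    split_ifs at h3 <;> omega
  refine ⟨hceq.1, fun x hx hxu y hxy => ?_⟩
  rw [hceq.2, ← smul_eq_mul, ← sum_const] at hs
  have heq := (sum_eq_sum_iff_of_le hle).1 hs.symm x (mem_erase.2 ⟨hxu, hx⟩)
  exact mem_of_deg_le_degIn ((hd.deg_le x).trans heq.ge) hxy

theorem Tight.exists_adj_mem_free (ht : Tight H L k δ) (hH : ¬ HasFactor H k) (hF : F ≤ H)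
    (hd : Deficient F k u v) (hu : u ∈ L) (hv : v ∉ L) (hn : ¬ H.Adj u v) {x : V} (hx : x ∈ L)
    (hxu : x ≠ u) : ∃ a ∈ free H F u, F.Adj a x := by
  have h1 := hd.deg_eq hxu (by rintro rfl; exact hv hx)
  have h2 := ht.one_le
  obtain ⟨a, ha⟩ := exists_adj_of_deg_pos (F := F) (x := x) (by omega)
  exact ⟨a, (ht.free_saturated hH hF hd hu hv hn).2 x hx hxu a ha, ha.symm⟩

/-- Otherwise the deficit moves from u via a to x, and from there via c to a clique vertex z (or is
removed by xc if c = v). -/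
theorem Tight.mem_free_of_adj (ht : Tight H L k δ) (hH : ¬ HasFactor H k) (hF : F ≤ H)
    (hd : Deficient F k u v) (hu : u ∈ L) (hv : v ∉ L) (hn : ¬ H.Adj u v) {x c : V} (hx : x ∈ L)
    (hxu : x ≠ u) (hc : c ∉ L) (hxc : H.Adj x c) : c ∈ free H F u := by
  by_contra hcf
  have hsat := (ht.free_saturated hH hF hd hu hv hn).2
  obtain ⟨a, ha, hax⟩ := ht.exists_adj_mem_free hH hF hd hu hv hn hx hxu
  have hca : c ≠ a := by
    rintro rfl
    exact hcf ha
  have hnxc : ¬ F.Adj x c := fun h => hcf (hsat x hx hxu c h)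
  rw [mem_free] at ha
  have hxa := hax.ne
  have h1 := hd.shift ha.1.ne ha.2 hax
  have hcu : c ≠ u := by
    rintro rfl
    exact hc hu
  have hn1 : ¬ (shift F u a x).Adj x c := by
    rw [shift_adj]
    grind
  have hle := shift_le (x := x) hF ha.1
  by_cases hcv : c = v
  · subst hcv
    exact hH (h1.hasFactor hle hn1 hxc)
  -- If u were the only F-neighbour of c, then k = 1, and u would have no F-neighbour at all.
  obtain ⟨z, hz, hzu⟩ : ∃ z, F.Adj c z ∧ z ≠ u := by
    by_contra! hall
    have hdc := hd.deg_eq hcu hcv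
    have h2 : deg F c ≤ #{u} := card_le_card fun y hy => by
      rw [mem_singleton]
      exact hall y (mem_filter.1 hy).2
    rw [card_singleton] at h2
    have h3 := ht.one_le
    obtain ⟨z, hz⟩ := exists_adj_of_deg_pos (F := F) (x := c) (by omega)
    obtain rfl := hall z hz
    have h4 := hd.deg_left (by rintro rfl; exact hv hu)
    have h5 : 0 < deg F z := card_pos.2 ⟨c, by simpa using hz.symm⟩
    omega
  have hzL : z ∉ L := fun h => hcf (hsat z h hzu c hz.symm)
  have h2 := h1.shift (a := c) (x := z) hxc.ne hn1 (by
    rw [shift_adj]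
    have := hxc.ne
    grind)
  exact hH (ht.repair h2 (shift_le hle hxc) hzL hv)

/-- For `k ≥ 2` a tight graph has a `k`-factor. -/
theorem Tight.hasFactor (ht : Tight H L k δ) (hk : 2 ≤ k) (hL : 2 ≤ #L) : HasFactor H k := by
  by_contra hH
  -- Clique neighbours of x are free for u, but the F-neighbour c of u is a clique neighbour of u
  -- that is not free. The strict inequality would hold in both directions.
  have key : ∀ u ∈ L, ∀ x ∈ L, x ≠ u → degIn H Lᶜ x < degIn H Lᶜ u := by
    intro u hu x hx hxu
    obtain ⟨v, hv, hn, F, hF, hd⟩ := ht.exists_deficient hH hu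
    have h1 := hd.deg_left (by rintro rfl; exact hv hu)
    obtain ⟨c, hc⟩ := exists_adj_of_deg_pos (F := F) (x := u) (by omega)
    have hcL : c ∉ L := fun h => (mem_free.1
      ((ht.free_saturated hH hF hd hu hv hn).2 c h hc.ne' u hc.symm)).1.ne rfl
    refine card_lt_card ⟨fun y hy => ?_, fun hsub => ?_⟩
    · simp only [mem_filter, mem_compl] at hy ⊢
      exact ⟨hy.1, (mem_free.1 (ht.mem_free_of_adj hH hF hd hu hv hn hx hxu hy.1 hy.2)).1⟩
    · have := @hsub c (by simpa using ⟨hcL, hF hc⟩)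
      simp only [mem_filter, mem_compl] at this
      exact (mem_free.1 (ht.mem_free_of_adj hH hF hd hu hv hn hx hxu hcL this.2)).2 hc
  obtain ⟨x, hx, y, hy, hxy⟩ := one_lt_card.1 hL
  exact lt_asymm (key x hx y hy hxy.symm) (key y hy x hx hxy)

/-- A tight graph without a `1`-factor is one of the two extremal graphs. -/
theorem Tight.extremal (ht : Tight H L 1 δ) (hL : L.Nonempty) (hH : ¬ HasFactor H 1) :
    (Even δ ∧ ∀ x ∈ L, ∀ y, H.Adj x y ↔ y ≠ x ∧ y ∈ L) ∨
      ∃ D : Finset V, #D = δ ∧ Disjoint D L ∧ ∀ x ∈ L, ∀ y, H.Adj x y ↔ y ∈ D := by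
  have hLδ : #L = δ + 1 := by
    have h1 := ht.threshold_add
    have h2 := ht.large
    simp only [threshold, if_true] at h1
    omega
  have hsame : ∀ u ∈ L, ∀ x ∈ L, ∀ c ∉ L, H.Adj x c → H.Adj u c := by
    intro u hu x hx c hc hxc
    by_cases hxu : x = u
    · exact hxu ▸ hxc
    obtain ⟨v, hv, hn, F, hF, hd⟩ := ht.exists_deficient hH hu
    exact (mem_free.1 (ht.mem_free_of_adj hH hF hd hu hv hn hx hxu hc hxc)).1
  obtain ⟨u, hu⟩ := hL
  obtain ⟨v, hv, hn, F, hF, hd⟩ := ht.exists_deficient hH hu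
  have huv : u ≠ v := by
    rintro rfl
    exact hv hu
  have hFu : ∀ y, ¬ F.Adj u y := fun y hy => by
    have h1 := hd.deg_left huv
    have h2 : 0 < deg F u := card_pos.2 ⟨y, by simpa using hy⟩
    omega
  by_cases hD : ∃ d ∉ L, H.Adj u d
  · right
    obtain ⟨d, hdL, hud⟩ := hD
    have hdf : d ∈ free H F u := mem_free.2 ⟨hud, hFu d⟩
    have hdd := hd.deg_eq hud.ne' (by rintro rfl; exact hn hud)
    obtain ⟨y, hdy⟩ := exists_adj_of_deg_pos (F := F) (x := d) (by omega)
    have hyL := ht.mem_of_adj_free hH hF hd hv hdf hdy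
    -- Here y in L is the F-partner of d. An edge yx would let the deficit travel from u via a to x,
    -- and via y to d in the clique.
    have hyx : ∀ x ∈ L, ¬ H.Adj y x := by
      intro x hx hyx
      have hxu : x ≠ u := by
        rintro rfl
        exact hdL (ht.mem_of_adj_free hH hF hd hv (mem_free.2 ⟨hyx.symm, hFu y⟩) hdy.symm)
      obtain ⟨a, ha, hax⟩ := ht.exists_adj_mem_free hH hF hd hu hv hn hx hxu
      rw [mem_free] at ha
      have hnxy : ¬ F.Adj y x := fun h => by
        have := eq_of_deg_le_one (hd.deg_le y) h hdy.symm
        exact hdL (this ▸ hx)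
      have hnxy' : ¬ F.Adj x y := fun h => hnxy h.symm
      have hyu : y ≠ u := by
        rintro rfl
        exact hFu d hdy.symm
      have hne := hyx.ne
      have hdx : d ≠ x := by
        rintro rfl
        exact hdL hx
      have hyd := hdy.symm
      have h1 := hd.shift ha.1.ne ha.2 hax
      have h2 := h1.shift (a := y) (x := d) hyx.ne' (by rw [shift_adj]; grind)
        (by rw [shift_adj]; grind)
      exact hH (ht.repair h2 (shift_le (shift_le hF ha.1) hyx.symm) hdL hv)
    -- All vertices of L have the same neighbours outside L, and y has no others; equal degrees then
    -- force equal neighbourhoods.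
    have hsub : ∀ x ∈ L, ({c | H.Adj y c} : Finset V) ⊆ ({c | H.Adj x c} : Finset V) := by
      intro x hx c hc
      simp only [mem_filter, mem_univ, true_and] at hc ⊢
      exact hsame x hx y hyL c (fun h => hyx c h hc) hc
    refine ⟨({c | H.Adj y c} : Finset V), ht.deg_eq y hyL, ?_, fun x hx z => ?_⟩
    · refine disjoint_left.2 fun c hc hcL => hyx c hcL ?_
      simpa using hc
    · have h1 : #({c | H.Adj x c} : Finset V) = δ := ht.deg_eq x hx
      have h2 : #({c | H.Adj y c} : Finset V) = δ := ht.deg_eq y hyL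
      rw [eq_of_subset_of_card_le (hsub x hx) (by omega)]
      simp
  · left
    push Not at hD
    have hadj : ∀ x ∈ L, ∀ y, H.Adj x y ↔ y ≠ x ∧ y ∈ L := by
      intro x hx y
      have hsub : ({c | H.Adj x c} : Finset V) ⊆ L.erase x := fun c hc => by
        simp only [mem_filter, mem_univ, true_and] at hc
        refine mem_erase.2 ⟨hc.ne', ?_⟩
        by_contra hcL
        exact hD c hcL (hsame u hu x hx c hcL hc)
      have h1 : #({c | H.Adj x c} : Finset V) = δ := ht.deg_eq x hx
      have h2 := card_erase_add_one hx
      have h3 := eq_of_subset_of_card_le hsub (by omega)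
      have h4 : y ∈ ({c | H.Adj x c} : Finset V) ↔ y ∈ L.erase x := by rw [h3]
      simpa using h4
    refine ⟨?_, hadj⟩
    -- F matches L \ {u}, a set of δ vertices, within itself.
    have h1 := even_sum_degIn F (L.erase u)
    have h2 : ∑ x ∈ L.erase u, degIn F (L.erase u) x = ∑ x ∈ L.erase u, 1 := by
      refine sum_congr rfl fun x hx => ?_
      rw [mem_erase] at hx
      rw [degIn_eq_deg, hd.deg_eq hx.1 (by rintro rfl; exact hv hx.2)]
      intro y hy
      have h3 := (hadj x hx.2 y).1 (hF hy)
      refine mem_erase.2 ⟨?_, h3.2⟩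
      rintro rfl
      exact hFu x hy.symm
    rw [h2, sum_const, smul_eq_mul, mul_one] at h1
    have h4 := card_erase_add_one hu
    rwa [show #(L.erase u) = δ by omega] at h1

end

/-! ### Identification of the extremal graphs and conclusion -/

section

open Finset
open scoped Classical

variable {V : Type*} [Fintype V]

theorem two_mul_choose_two (m : ℕ) : 2 * (Ring.choose (m : ℤ) 2) = m * (m - 1) := by
  rw [Ring.choose_natCast, Nat.choose_two_right]
  have h : 2 * (m * (m - 1) / 2) = m * (m - 1) :=
    Nat.mul_div_cancel' (Nat.even_mul_pred_self m).two_dvd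
  rcases m with _ | m
  · simp
  · have : ((2 * ((m + 1) * (m + 1 - 1) / 2) : ℕ) : ℤ) = ((m + 1) * (m + 1 - 1) : ℕ) := by rw [h]
    push_cast at this ⊢
    simpa using this

/-- For k = 1, t = δ + 1 and for k ≥ 2, t = δ + 4 - 2k, the left side of `he` is 2φ(n,2,δ+1) and
2ϕ(n,2,k,δ+1) respectively. -/
theorem hasFactor_or_tight {G : SimpleGraph V} {k t δ : ℕ}
    (hth : threshold (Fintype.card V) k + t = Fintype.card V + δ) (hδ : ∀ z, δ ≤ deg G z)
    (hk : 1 ≤ k) (hev : Even (Fintype.card V * k)) (hn : 5 * t + δ + 5 ≤ Fintype.card V)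
    (hlarge : 2 * t + 2 * k + 4 < Fintype.card V)
    (he : ((Fintype.card V : ℤ) - t - 1) * (Fintype.card V - t - 2) + 2 * ((t + 1) * (δ + 1)) <
      (∑ z, deg G z : ℕ)) :
    HasFactor G k ∨
      ∃ L, #L = t ∧ Tight (closure (threshold (Fintype.card V) k) G) L k δ := by
  have hH := closure_isClosure (threshold (Fintype.card V) k) G
  by_cases hne : ∃ u v, u ≠ v ∧ ¬ (closure (threshold (Fintype.card V) k) G).Adj u v
  · right
    have hle : ∑ z, deg G z ≤ ∑ z, deg (closure (threshold (Fintype.card V) k) G) z :=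
      sum_le_sum fun z _ => deg_mono hH.le z
    obtain ⟨L, hL, hd, hc⟩ := exists_clique_compl hth hH.2
      (fun z => (hδ z).trans (deg_mono hH.le z)) hn (by omega) hne
    subst hL
    exact ⟨L, rfl, hth, hd, hc, hk, hev, hlarge, by omega⟩
  · left
    push Not at hne
    refine hasFactor_of_closure ?_
    rw [show closure (threshold (Fintype.card V) k) G = ⊤ from
      top_le_iff.1 fun x y hxy => hne x y hxy]
    exact hasFactor_top (by omega) hev

theorem exists_equiv_of_card_fiber {α β γ : Type*} [Fintype α] [Fintype β] [DecidableEq γ]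
    {f : α → γ} {g : β → γ}
    (h : ∀ c, #({a | f a = c} : Finset α) = #({b | g b = c} : Finset β)) :
    ∃ e : α ≃ β, ∀ a, g (e a) = f a := by
  refine ⟨Equiv.ofFiberEquiv fun c => Fintype.equivOfCardEq ?_, Equiv.ofFiberEquiv_map _⟩
  rw [Fintype.card_subtype, Fintype.card_subtype]
  exact h c

theorem sum_complete_adj {α β : Type*} (p q : α ⊕ β) :
    (SimpleGraph.completeGraph α ⊕g SimpleGraph.completeGraph β).Adj p q ↔
      p ≠ q ∧ p.isRight = q.isRight := by
  rcases p with p | p <;> rcases q with q | q <;> simp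

theorem card_isRight {a b : ℕ} (i : Bool) :
    #({p | p.isRight = i} : Finset (Fin a ⊕ Fin b)) = if i then b else a := by
  rw [Finset.card_filter, Fintype.sum_sum_type]
  cases i <;> simp

theorem nonempty_iso_sum_complete {H : SimpleGraph V} {L : Finset V} {a b : ℕ} (hL : #L = b)
    (hab : a + b = Fintype.card V) (hC : ∀ x ∉ L, ∀ y ∉ L, x ≠ y → H.Adj x y)
    (hA : ∀ x ∈ L, ∀ y, H.Adj x y ↔ y ≠ x ∧ y ∈ L) :
    Nonempty (H ≃g SimpleGraph.completeGraph (Fin a) ⊕g SimpleGraph.completeGraph (Fin b)) := by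
  have hLc := card_compl_add_card L
  obtain ⟨e, he⟩ := exists_equiv_of_card_fiber (f := fun x : V => decide (x ∈ L))
    (g := fun p : Fin a ⊕ Fin b => p.isRight) (by
      rintro (_ | _)
      · have h1 : ({x | decide (x ∈ L) = false} : Finset V) = Lᶜ := by
          ext
          simp
        rw [h1, card_isRight, if_neg (by simp)]
        omega
      · have h1 : ({x | decide (x ∈ L) = true} : Finset V) = L := by
          ext
          simp
        rw [h1, card_isRight, if_pos rfl, hL])
  refine ⟨⟨e, ?_⟩⟩
  intro x y
  rw [sum_complete_adj, he, he, e.injective.ne_iff, decide_eq_decide]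
  by_cases hx : x ∈ L
  · rw [hA x hx]
    simp [hx, ne_comm]
  · by_cases hy : y ∈ L
    · rw [H.adj_comm, hA y hy]
      simp [hx, hy]
    · simp only [hx, hy, and_true]
      exact ⟨hC x hx y hy, fun h => h.ne⟩

/-- The part of a vertex of `K ∨ (K + I)`. -/
def part {α β γ : Type*} : α ⊕ (β ⊕ γ) → Fin 3
  | .inl _ => 0
  | .inr (.inl _) => 1
  | .inr (.inr _) => 2

theorem join_complete_adj {α β γ : Type*} (p q : α ⊕ (β ⊕ γ)) :
    (join (SimpleGraph.completeGraph α)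
      (SimpleGraph.completeGraph β ⊕g SimpleGraph.emptyGraph γ)).Adj p q ↔
      p ≠ q ∧ (part p = 2 → part q = 0) ∧ (part q = 2 → part p = 0) := by
  rcases p with p | p | p <;> rcases q with q | q | q <;> simp [join, part]

theorem card_part {a b c : ℕ} (i : Fin 3) :
    #({p | part p = i} : Finset (Fin a ⊕ (Fin b ⊕ Fin c))) = ![a, b, c] i := by
  rw [Finset.card_filter, Fintype.sum_sum_type, Fintype.sum_sum_type]
  fin_cases i <;> simp [part]

theorem nonempty_iso_join {H : SimpleGraph V} {L D : Finset V} {a b c : ℕ} (hL : #L = c)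
    (hD : #D = a) (hDL : Disjoint D L) (habc : a + b + c = Fintype.card V)
    (hC : ∀ x ∉ L, ∀ y ∉ L, x ≠ y → H.Adj x y) (hA : ∀ x ∈ L, ∀ y, H.Adj x y ↔ y ∈ D) :
    Nonempty (H ≃g join (SimpleGraph.completeGraph (Fin a))
      (SimpleGraph.completeGraph (Fin b) ⊕g SimpleGraph.emptyGraph (Fin c))) := by
  have hc := card_compl_add_card (D ∪ L)
  rw [card_union_of_disjoint hDL] at hc
  have hdis : ∀ x ∈ D, x ∉ L := fun x hx hx' => disjoint_left.1 hDL hx hx'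
  let f : V → Fin 3 := fun x => if x ∈ D then 0 else if x ∈ L then 2 else 1
  have hf0 : ∀ x, f x = 0 ↔ x ∈ D := fun x => by
    simp only [f]
    split_ifs <;> simp_all
  have hf2 : ∀ x, f x = 2 ↔ x ∈ L := fun x => by
    have := hdis x
    simp only [f]
    split_ifs <;> simp_all
  have hf1 : ∀ x, f x = 1 ↔ x ∈ (D ∪ L)ᶜ := fun x => by
    simp only [f]
    split_ifs <;> simp_all
  obtain ⟨e, he⟩ := exists_equiv_of_card_fiber (f := f)
    (g := fun p : Fin a ⊕ (Fin b ⊕ Fin c) => part p) (by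
      intro i
      rw [card_part]
      fin_cases i
      · simp [hf0, hD]
      · simp only [Fin.mk_one, hf1]
        simp only [filter_univ_mem, Matrix.cons_val_one, Matrix.cons_val_zero]
        omega
      · simp [hf2, hL])
  refine ⟨⟨e, ?_⟩⟩
  intro x y
  rw [join_complete_adj, he, he, e.injective.ne_iff, hf0, hf0, hf2, hf2]
  have hdx := hdis x
  have hdy := hdis y
  by_cases hx : x ∈ L
  · have : x ≠ y ∨ x = y := (eq_or_ne x y).symm
    rw [hA x hx]
    grind
  · by_cases hy : y ∈ L
    · rw [H.adj_comm, hA y hy]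
      grind
    · have := hC x hx y hy
      have h2 : H.Adj x y → x ≠ y := fun h => h.ne
      grind

/-- A 1-factor would match the odd clique within itself. -/
theorem not_hasFactor_of_iso_sum {H : SimpleGraph V} {a b : ℕ} (hb : Odd b)
    (e : H ≃g SimpleGraph.completeGraph (Fin a) ⊕g SimpleGraph.completeGraph (Fin b)) :
    ¬ HasFactor H 1 := by
  intro h
  obtain ⟨F, hF, hd⟩ := hasFactor_iff.1 h
  have hc : #({x | (e x).isRight = true} : Finset V) = b := by
    rw [card_equiv e.toEquiv (t := {p | p.isRight = true}) (by simp), card_isRight, if_pos rfl]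
  have h1 := even_sum_degIn F ({x | (e x).isRight = true} : Finset V)
  rw [sum_congr rfl (g := fun _ => 1), sum_const, hc, smul_eq_mul, mul_one] at h1
  · exact Nat.not_even_iff_odd.2 hb h1
  · intro x hx
    rw [← hd x, degIn_eq_deg]
    intro y hy
    have h2 := ((sum_complete_adj _ _).1 (e.map_adj_iff.2 (hF hy))).2
    simp only [mem_filter, mem_univ, true_and] at hx ⊢
    rw [← h2, hx]

/-- A 1-factor would match the c independent vertices into the a < c vertices of the first part. -/
theorem not_hasFactor_of_iso_join {H : SimpleGraph V} {a b c : ℕ} (hac : a < c)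
    (e : H ≃g join (SimpleGraph.completeGraph (Fin a))
      (SimpleGraph.completeGraph (Fin b) ⊕g SimpleGraph.emptyGraph (Fin c))) :
    ¬ HasFactor H 1 := by
  intro h
  obtain ⟨F, hF, hd⟩ := hasFactor_iff.1 h
  have hc : ∀ i, #({x | part (e x) = i} : Finset V) = ![a, b, c] i := fun i => by
    rw [card_equiv e.toEquiv (t := {p | part p = i}) (by simp), card_part]
  have h1 := sum_deg_eq_sum_degIn (F := F) (P := ({x | part (e x) = 2} : Finset V))
    (Q := ({x | part (e x) = 0} : Finset V)) fun p hp q hq => by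
      have h2 := ((join_complete_adj _ _).1 (e.map_adj_iff.2 (hF hq))).2
      simp only [mem_filter, mem_univ, true_and] at hp ⊢
      exact h2.1 hp
  rw [sum_congr rfl fun p _ => hd p, sum_const, hc] at h1
  have h3 := sum_le_card_nsmul ({x | part (e x) = 0} : Finset V) _ 1 fun q _ =>
    (degIn_le_deg F ({x | part (e x) = 2} : Finset V) q).trans (hd q).le
  rw [← h1, hc] at h3
  simp at h3
  omega

end

theorem hasFactor_one_iff {V : Type*} [Fintype V] (G : SimpleGraph V) [DecidableRel G.Adj]
    (n δ : ℕ) (hn : Fintype.card V = n) (hδ : δ ≤ G.minDegree) (hev : Even n)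
    (hlarge : 6 * δ + 10 ≤ n) (he : (G.edgeFinset.card : ℤ) > phiOne n 2 (δ + 1)) :
    HasFactor G 1 ↔
      ¬ ((Even δ ∧ Nonempty (closure (n - 1) G ≃g
            (SimpleGraph.completeGraph (Fin (n - δ - 1)) ⊕g
              SimpleGraph.completeGraph (Fin (δ + 1))))) ∨
         Nonempty (closure (n - 1) G ≃g
            join (SimpleGraph.completeGraph (Fin δ))
              (SimpleGraph.completeGraph (Fin (n - 2 * δ - 1)) ⊕g
                SimpleGraph.emptyGraph (Fin (δ + 1))))) := by
  subst hn
  constructor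
  · intro h hex
    have h' := h.mono (closure_isClosure (Fintype.card V - 1) G).le
    rcases hex with ⟨hδe, ⟨e⟩⟩ | ⟨⟨e⟩⟩
    · exact not_hasFactor_of_iso_sum hδe.add_one e h'
    · exact not_hasFactor_of_iso_join (Nat.lt_succ_self δ) e h'
  · intro hex
    by_contra hno
    have hth : threshold (Fintype.card V) 1 = Fintype.card V - 1 := by simp [threshold]
    obtain h | ⟨L, hL, ht⟩ := hasFactor_or_tight (G := G) (k := 1) (t := δ + 1) (δ := δ)
      (by rw [hth]; omega)
      (fun z => by rw [← degree_eq_deg G z]; exact hδ.trans (G.minDegree_le_degree z))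
      le_rfl (by simpa using hev) (by omega) (by omega) (by
        rw [sum_deg_eq_two_mul_card_edgeFinset G]
        have h1 := two_mul_choose_two (Fintype.card V - δ - 2)
        have h2 : ((Fintype.card V - δ - 2 : ℕ) : ℤ) = Fintype.card V - (δ + 1) - 1 := by omega
        rw [h2] at h1
        rw [phiOne, Ring.choose_one_right] at he
        push_cast
        linarith)
    · exact hno h
    · rw [hth] at ht
      have hH : ¬ HasFactor (closure (Fintype.card V - 1) G) 1 := fun h =>
        hno (hasFactor_of_closure (by rwa [hth]))
      refine hex ?_
      obtain ⟨h1, h2⟩ | ⟨D, h1, h2, h3⟩ := ht.extremal (Finset.card_pos.1 (by omega)) hH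
      · exact Or.inl ⟨h1, nonempty_iso_sum_complete hL (by omega) ht.clique h2⟩
      · exact Or.inr (nonempty_iso_join hL h1 h2 (by omega) ht.clique h3)

theorem hasFactor_of_two_le {V : Type*} [Fintype V] (G : SimpleGraph V) [DecidableRel G.Adj]
    (n δ k : ℕ) (hn : Fintype.card V = n) (hδ : δ ≤ G.minDegree) (hk : 2 ≤ k)
    (hev : Even (n * k)) (hlarge : 6 * δ + 4 * k - 3 ≤ n) (hkδ : 2 * k - 2 ≤ δ)
    (he : (G.edgeFinset.card : ℤ) > phiTwo n 2 k (δ + 1)) : HasFactor G k := by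
  subst hn
  by_contra hno
  have hth : threshold (Fintype.card V) k = Fintype.card V + 2 * k - 4 := by
    rw [threshold, if_neg (by omega)]
  obtain h | ⟨L, hL, ht⟩ := hasFactor_or_tight (G := G) (k := k) (t := δ + 4 - 2 * k) (δ := δ)
    (by rw [hth]; omega)
    (fun z => by rw [← degree_eq_deg G z]; exact hδ.trans (G.minDegree_le_degree z))
    (by omega) hev (by omega) (by omega) (by
      rw [sum_deg_eq_two_mul_card_edgeFinset G]
      have h1 := two_mul_choose_two (Fintype.card V + 2 * k - δ - 5)
      have h2 : ((Fintype.card V + 2 * k - δ - 5 : ℕ) : ℤ) =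
        Fintype.card V - (δ + 1) + 2 * k - 4 := by omega
      rw [h2] at h1
      rw [phiTwo, Ring.choose_one_right] at he
      have h3 : ((δ + 4 - 2 * k : ℕ) : ℤ) = δ + 4 - 2 * k := by omega
      rw [h3]
      push_cast
      linarith)
  · exact hno h
  -- Here |L| = δ + 4 - 2k ≥ 2 because δ ≥ 2k - 2.
  · exact hno (hasFactor_of_closure (ht.hasFactor hk (by omega)))

end KFactor

theorem corollary1p5 {V : Type*} [Fintype V] (G : SimpleGraph V) [DecidableRel G.Adj]
    (n δ : ℕ) (hn : Fintype.card V = n) (hδ : δ ≤ G.minDegree) :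
    (Even n → 6 * δ + 10 ≤ n → 1 ≤ δ → δ ≤ n / 2 - 1 →
      (G.edgeFinset.card : ℤ) > KFactor.phiOne n 2 (δ + 1) →
      (KFactor.HasFactor G 1 ↔
        ¬ ((Even δ ∧ Nonempty (KFactor.closure (n - 1) G ≃g
              (SimpleGraph.completeGraph (Fin (n - δ - 1)) ⊕g SimpleGraph.completeGraph (Fin (δ + 1))))) ∨
           Nonempty (KFactor.closure (n - 1) G ≃g
              KFactor.join (SimpleGraph.completeGraph (Fin δ))
                (SimpleGraph.completeGraph (Fin (n - 2 * δ - 1)) ⊕g SimpleGraph.emptyGraph (Fin (δ + 1))))))) ∧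
    (∀ k : ℕ, 2 ≤ k → Even (n * k) → 6 * δ + 4 * k - 3 ≤ n →
      2 * k - 2 ≤ δ → δ ≤ (n + 2 * k - 5) / 2 →
      (G.edgeFinset.card : ℤ) > KFactor.phiTwo n 2 k (δ + 1) →
      KFactor.HasFactor G k) := by
  refine ⟨fun hev hlarge _ _ he => KFactor.hasFactor_one_iff G n δ hn hδ hev hlarge he, ?_⟩
  exact fun k hk hev hlarge hkδ _ he =>
    KFactor.hasFactor_of_two_le G n δ k hn hδ hk hev hlarge hkδ he
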